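/- For a field $K$ and an integer $t\ge 0$, let $B_{\mathrm m}(t,K)\in\mathbb{N}\cup\{\infty\}$ denote the supremum of the number of roots in $K^*=K\setminus\{0\}$, counted with multiplicities, over all non-zero polynomials in $K[x]$ with at most $t+1$ monomial terms. Let $p$ be a prime number, let $K/\mathbb{Q}_p$ be a finite extension with ramification index $e$ and residue class degree $f$, and let $t\ge 0$ be an integer. Assume that $p>e+t$. Then $$B_{\mathrm m}(t,K)\le (t^2-t+1)\,(p^f-1).$$ -/

import Mathlib

open Polynomial

open scoped Classical in
/-- The number of roots of `g` in `K* = K \ {0}`, counted with multiplicity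
(for `g ≠ 0`; Mathlib's `roots` of the zero polynomial is empty). -/
noncomputable def numNonzeroRoots {K : Type*} [Field K] (g : K[X]) : ℕ :=
  (g.roots.filter (fun x => x ≠ 0)).card

/-- `B_m(t, K)`: the supremum, in `ℕ ∪ {∞}`, of the number of roots in `K*`, counted with
multiplicity, of a nonzero polynomial in `K[x]` with at most `t + 1` monomial terms. -/
noncomputable def Bmult (t : ℕ) (K : Type*) [Field K] : ℕ∞ :=
  ⨆ g : {g : K[X] // g ≠ 0 ∧ g.support.card ≤ t + 1}, (numNonzeroRoots g.1 : ℕ∞)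

/-! ### Valuations of integers and factorials -/

section Valuation

variable {K Γ : Type*} [Field K] [LinearOrderedCommGroupWithZero Γ] (v : Valuation K Γ)

/-! Write `g = ∑ g_i X^i` and `|·|` for the valuation. Attach to a nonzero root `x` the largest
index `top x` at which `|g_i x^i|` is maximal, the right end of a Newton polygon edge. It is never
the least exponent, so it takes at most `t` values, and roots with the same `top` have the same
absolute value. Dividing such a class by one of its members and reducing splits it into at most `p^f
- 1` discs `|x - x₀| ≤ |π x₀|`.

Every such disc holds at most `t` roots (`card_roots_near_le_of_card_support_le`). On the `t + 1`
exponents, each `k! * choose i k` is an integer combination of the `j! * choose i j` with `j ≤ t`,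
so the scaled Taylor coefficients of order above `t` are controlled by the lower ones up to `k!`;
the hypothesis `e + t < p` makes that loss harmless.

For one special value `α` of `top` the disc holds at most one root (`card_roots_near_le_one`): there
the linear Taylor coefficient dominates all later ones. The total is `(1 + (t - 1) t)(p^f - 1)`. -/

theorem Valuation.map_intCast_le_one (n : ℤ) : v (n : K) ≤ 1 := by
  induction n using Int.induction_on with
  | zero => simp
  | succ i ih =>
    push_cast at ih ⊢
    exact (v.map_add _ _).trans (max_le ih (by simp))
  | pred i ih =>
    push_cast at ih ⊢
    exact (v.map_sub _ _).trans (max_le ih (by simp))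

theorem Valuation.map_nat_le_one (n : ℕ) : v (n : K) ≤ 1 := by
  simpa using v.map_intCast_le_one n

variable {v} {p : ℕ} [Fact p.Prime]

theorem Valuation.map_natCast_eq_one (hp : v (p : K) < 1) {n : ℕ} (hn : ¬ p ∣ n) :
    v (n : K) = 1 := by
  refine le_antisymm (v.map_nat_le_one n) (not_lt.1 fun hlt => ?_)
  have hc : Nat.Coprime p n := ((Fact.out : p.Prime).coprime_iff_not_dvd).2 hn
  have hb := Nat.gcd_eq_gcd_ab p n
  rw [hc.gcd_eq_one] at hb
  have hb' : (1 : K) = p * (p.gcdA n : ℤ) + n * (p.gcdB n : ℤ) := by exact_mod_cast congrArg (Int.cast : ℤ → K) hb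
  have : v (1 : K) < 1 := by
    rw [hb']
    refine v.map_add_lt ?_ ?_
    · rw [map_mul]; exact mul_lt_one_of_lt_of_le hp (v.map_intCast_le_one _)
    · rw [map_mul]; exact mul_lt_one_of_lt_of_le hlt (v.map_intCast_le_one _)
  simp at this

theorem Valuation.map_natCast_eq_pow (hp : v (p : K) < 1) {n : ℕ} (hn : n ≠ 0) :
    v (n : K) = v (p : K) ^ padicValNat p n := by
  obtain ⟨m, hm⟩ := pow_padicValNat_dvd (p := p) (n := n)
  have hpm : ¬ p ∣ m := by
    rintro ⟨l, rfl⟩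
    refine pow_succ_padicValNat_not_dvd (p := p) hn ⟨l, ?_⟩
    rw [pow_succ, mul_assoc]
    exact hm
  conv_lhs => rw [hm]
  rw [Nat.cast_mul, map_mul, Valuation.map_natCast_eq_one hp hpm, mul_one, Nat.cast_pow, map_pow]

/-- Legendre's formula gives `(p - 1) ν < k` for `ν = ord_p k!`. Since `e + s ≤ p - 1`, this yields
`(e + s) ν ≤ k - 1`, hence `e ν < k - s` as soon as `ν ≥ 1`. -/
theorem Valuation.pow_sub_lt_map_factorial {π : K} {e s k : ℕ} (hπ : v π < 1) (hπ0 : π ≠ 0)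
    (he : 0 < e) (hpe : v (p : K) = v π ^ e) (hs : e + s < p) (hk : s < k) :
    v π ^ (k - s) < v (k.factorial : K) := by
  have h0 : 0 < v π := (v.pos_iff).2 hπ0
  have hp : v (p : K) < 1 := hpe ▸ pow_lt_one₀ zero_le hπ he.ne'
  rw [Valuation.map_natCast_eq_pow hp k.factorial_ne_zero, hpe, ← pow_mul]
  refine pow_lt_pow_right_of_lt_one₀ h0 hπ ?_
  have hlt := sub_one_mul_padicValNat_factorial_lt_of_ne_zero p (n := k) (by omega)
  set ν := padicValNat p k.factorial with hν
  rcases Nat.eq_zero_or_pos ν with h | h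
  · rw [h]; simpa using hk
  · have hkp : p ≤ k := by
      by_contra hlt
      have : ¬ p ∣ k.factorial := by
        rw [(Fact.out : p.Prime).dvd_factorial]; omega
      rw [hν, padicValNat.eq_zero_of_not_dvd this] at h
      exact absurd h (by simp)
    have h1 : (e + s) * ν ≤ k - 1 := (Nat.mul_le_mul_right ν (by omega)).trans (Nat.le_sub_one_of_lt hlt)
    obtain ⟨d, rfl⟩ : ∃ d, k = e + s + 1 + d := ⟨k - (e + s + 1), by omega⟩
    zify [hk.le] at *
    rw [Nat.cast_sub (by omega)] at h1
    push_cast at *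
    have : (0:ℤ) ≤ d := by positivity
    nlinarith

end Valuation

/-! ### Counting integral roots by reduction -/

section IntegralRoots

variable {K Γ : Type*} [Field K] [LinearOrderedCommGroupWithZero Γ] {v : Valuation K Γ}

/-- After scaling its dominant coefficient to 1, `G` reduces to a nonzero polynomial of degree at
most `d` over the residue field. The monic product over the integral roots divides it and keeps its
degree under reduction. -/
theorem Polynomial.card_le_of_coeff_lt {G : K[X]} {d : ℕ}
    (hG : ∃ j ≤ d, ∀ k, d < k → v (G.coeff k) < v (G.coeff j))
    {s : Multiset K} (hs : s ≤ G.roots) (hsv : ∀ y ∈ s, v y ≤ 1) : s.card ≤ d := by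
  classical
  obtain ⟨j₀, hj₀, hlt⟩ := hG
  obtain ⟨j, hj, hmax⟩ := (Finset.range (d + 1)).exists_max_image (fun i => v (G.coeff i)) ⟨0, by simp⟩
  have hjpos : 0 < v (G.coeff j) :=
    (zero_le.trans_lt (hlt (d + 1) (by omega))).trans_le (hmax j₀ (by simpa using Nat.lt_succ_of_le hj₀))
  have hj0 : G.coeff j ≠ 0 := v.pos_iff.1 hjpos
  have hlt' : ∀ k, d < k → v (G.coeff k) < v (G.coeff j) := fun k hk =>
    (hlt k hk).trans_le (hmax j₀ (by simpa using Nat.lt_succ_of_le hj₀))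
  have hle : ∀ k, v (G.coeff k) ≤ v (G.coeff j) := fun k => by
    rcases lt_or_ge d k with h | h
    · exact (hlt' k h).le
    · exact hmax k (by simpa using Nat.lt_succ_of_le h)
  let A := v.valuationSubring
  have hcoeff : ∀ k, v ((C (G.coeff j)⁻¹ * G).coeff k) = v (G.coeff k) / v (G.coeff j) := fun k => by
    rw [coeff_C_mul, map_mul, map_inv₀, div_eq_inv_mul]
  have hlift : C (G.coeff j)⁻¹ * G ∈ lifts (algebraMap A K) := by
    rw [lifts_iff_coeff_lifts]
    intro k
    refine ⟨⟨(C (G.coeff j)⁻¹ * G).coeff k, ?_⟩, rfl⟩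
    rw [Valuation.mem_valuationSubring_iff, hcoeff]
    exact div_le_one_of_le₀ (hle k) zero_le
  obtain ⟨P, hP⟩ := hlift
  rw [coe_mapRingHom] at hP
  have hPc : ∀ k, ((P.coeff k : A) : K) = (C (G.coeff j)⁻¹ * G).coeff k := fun k => by
    rw [← hP, coeff_map]; rfl
  let S : Multiset A := s.attach.map fun y => ⟨y.1, hsv y.1 y.2⟩
  have hSs : S.map (algebraMap A K) = s := by
    rw [Multiset.map_map]
    exact s.attach_map_val
  have hmonic : (S.map fun a => X - C a).prod.Monic := monic_multiset_prod_of_monic _ _ fun a _ => monic_X_sub_C a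
  have hdvd : (S.map fun a => X - C a).prod ∣ P := by
    rw [← map_dvd_map (algebraMap A K) (IsFractionRing.injective A K) hmonic, hP,
      Polynomial.map_multiset_prod, Multiset.map_map]
    have : (S.map (Polynomial.map (algebraMap A K) ∘ fun a => X - C a)) = s.map fun a => X - C a := by
      conv_rhs => rw [← hSs, Multiset.map_map]
      refine Multiset.map_congr rfl fun a _ => ?_
      simp
    rw [this]
    refine Dvd.dvd.mul_left ?_ _
    exact (Multiset.prod_dvd_prod_of_le (Multiset.map_le_map hs)).trans (prod_multiset_X_sub_C_dvd G)
  have hdvd' := Polynomial.map_dvd (IsLocalRing.residue A) hdvd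
  have hPj : (P.map (IsLocalRing.residue A)).coeff j ≠ 0 := by
    rw [coeff_map, IsLocalRing.residue_ne_zero_iff_isUnit]
    have : P.coeff j = 1 := by
      apply Subtype.ext
      rw [hPc, coeff_C_mul, inv_mul_cancel₀ hj0]; rfl
    rw [this]; exact isUnit_one
  have hdeg : (P.map (IsLocalRing.residue A)).natDegree ≤ d := by
    rw [natDegree_le_iff_coeff_eq_zero]
    intro k hk
    rw [coeff_map, IsLocalRing.residue_eq_zero_iff, Valuation.mem_maximalIdeal_iff, hPc, hcoeff]
    exact (div_lt_one₀ hjpos).2 (hlt' k hk)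
  have h1 := natDegree_le_of_dvd hdvd' (fun h => hPj (by rw [h, coeff_zero]))
  rw [(hmonic.natDegree_map _), natDegree_multiset_prod_of_monic _ (by
    intro f hf
    obtain ⟨a, _, rfl⟩ := Multiset.mem_map.1 hf
    exact monic_X_sub_C a)] at h1
  have hcard : S.card = s.card := by simp [S]
  simp only [Multiset.map_map, Function.comp_def, natDegree_X_sub_C, Multiset.map_const', Multiset.sum_replicate, smul_eq_mul, mul_one] at h1
  omega

end IntegralRoots

/-! ### Integer relations between falling factorials on a finite set -/

section FallingFactorials

theorem Polynomial.exists_eq_sum_descPochhammer (d : ℕ) (R : ℤ[X]) (hR : R.degree < d) :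
    ∃ n : ℕ → ℤ, R = ∑ j ∈ Finset.range d, C (n j) * descPochhammer ℤ j := by
  induction d generalizing R with
  | zero => exact ⟨0, by simpa using hR⟩
  | succ d ih =>
    have hd : (descPochhammer ℤ d).coeff d = 1 := by
      conv_lhs => rw [← descPochhammer_natDegree (R := ℤ) d]
      rw [descPochhammer_natDegree]
      have := monic_descPochhammer ℤ d
      rwa [Monic, leadingCoeff, descPochhammer_natDegree] at this
    obtain ⟨n, hn⟩ := ih (R - C (R.coeff d) * descPochhammer ℤ d) (by
      rw [degree_lt_iff_coeff_zero] at hR ⊢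
      intro m hm
      rw [coeff_sub, coeff_C_mul]
      rcases hm.eq_or_lt with rfl | hm
      · rw [hd, mul_one, sub_self]
      · rw [hR m hm, coeff_eq_zero_of_natDegree_lt (p := descPochhammer ℤ d)
          (by rwa [descPochhammer_natDegree]), mul_zero, sub_zero])
    refine ⟨Function.update n d (R.coeff d), ?_⟩
    rw [Finset.sum_range_succ, Function.update_self, ← sub_eq_iff_eq_add, hn]
    refine Finset.sum_congr rfl fun j hj => ?_
    rw [Function.update_of_ne (Finset.mem_range.1 hj).ne]

/-- Divide the falling factorial of order `k` by the monic `∏ (X - i)`, `i ∈ S`. The remainder is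
integral of degree below `d`, agrees with it on `S`, and expands over `ℤ` in falling factorials. -/
theorem Nat.exists_factorial_mul_choose_eq_sum {S : Finset ℕ} {d : ℕ} (hS : S.card ≤ d) (k : ℕ) :
    ∃ n : ℕ → ℤ, ∀ i ∈ S, (k.factorial * i.choose k : ℤ) =
      ∑ j ∈ Finset.range d, n j * (j.factorial * i.choose j) := by
  let Q : ℤ[X] := ∏ i ∈ S, (X - C (i : ℤ))
  have hQ : Q.Monic := monic_prod_of_monic _ _ fun i _ => monic_X_sub_C _
  have heval : ∀ i j : ℕ, (descPochhammer ℤ j).eval (i : ℤ) = j.factorial * i.choose j :=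
    fun i j => by
      rw [descPochhammer_eval_eq_descFactorial, Nat.descFactorial_eq_factorial_mul_choose]
      push_cast; rfl
  have hQd : Q.degree ≤ d := by
    rw [degree_eq_natDegree hQ.ne_zero, natDegree_prod_of_monic _ _ fun i _ => monic_X_sub_C _]
    simp only [natDegree_X_sub_C, Finset.sum_const, smul_eq_mul, mul_one]
    exact_mod_cast hS
  obtain ⟨n, hn⟩ := exists_eq_sum_descPochhammer d (descPochhammer ℤ k %ₘ Q)
    ((degree_modByMonic_lt _ hQ).trans_le hQd)
  refine ⟨n, fun i hi => ?_⟩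
  have h := congrArg (eval (i : ℤ)) (modByMonic_add_div (descPochhammer ℤ k) Q)
  have hQi : Q.eval (i : ℤ) = 0 := by
    rw [eval_prod]
    exact Finset.prod_eq_zero hi (by simp)
  rw [eval_add, eval_mul, hQi, zero_mul, add_zero, hn, eval_finsetSum, heval] at h
  rw [← h]
  refine Finset.sum_congr rfl fun j _ => ?_
  rw [eval_mul, eval_C, heval]

end FallingFactorials

/-! ### Roots in a small disc -/

section LocalBounds

variable {K Γ : Type*} [Field K] [LinearOrderedCommGroupWithZero Γ] {v : Valuation K Γ}

theorem Polynomial.coeff_taylor_mul_pow (g : K[X]) (x : K) (k : ℕ) :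
    (taylor x g).coeff k * x ^ k = ∑ i ∈ g.support, g.coeff i * x ^ i * (i.choose k : K) := by
  rw [taylor_coeff, hasseDeriv_apply, Polynomial.sum, eval_finsetSum, Finset.sum_mul]
  refine Finset.sum_congr rfl fun i _ => ?_
  rw [eval_monomial]
  rcases lt_or_ge i k with h | h
  · simp [Nat.choose_eq_zero_of_lt h]
  · obtain ⟨l, rfl⟩ := Nat.exists_eq_add_of_le' h
    rw [Nat.add_sub_cancel, pow_add]; ring

/-- The substitution `x = x₀ + π x₀ y` turns the disc into the integral `y`. -/
theorem Polynomial.card_roots_near_le {g : K[X]} {x₀ π : K} (hx₀ : x₀ ≠ 0) (hπ : π ≠ 0) {d : ℕ}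
    (hd : ∃ j ≤ d, ∀ k, d < k → v (π ^ k * ((taylor x₀ g).coeff k * x₀ ^ k)) <
      v (π ^ j * ((taylor x₀ g).coeff j * x₀ ^ j)))
    {s : Multiset K} (hs : s ≤ g.roots) (hsv : ∀ x ∈ s, v (x - x₀) ≤ v (π * x₀)) :
    s.card ≤ d := by
  have hu : π * x₀ ≠ 0 := mul_ne_zero hπ hx₀
  have hcomp : g.comp (C (π * x₀) * X + C x₀) = (taylor x₀ g).comp (C (π * x₀) * X) := by
    rw [taylor_apply, comp_assoc]; simp
  have hcoeff : ∀ k, (g.comp (C (π * x₀) * X + C x₀)).coeff k =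
      π ^ k * ((taylor x₀ g).coeff k * x₀ ^ k) := fun k => by
    rw [hcomp, comp_C_mul_X_coeff, mul_pow]; ring
  have := Polynomial.card_le_of_coeff_lt (v := v) (G := g.comp (C (π * x₀) * X + C x₀)) (d := d)
    (by simpa only [hcoeff] using hd) (s := s.map fun x => Ring.inverse (π * x₀) * (x - x₀))
    (by
      rw [roots_comp_C_mul_X_add_C _ _ _ hu.isUnit]
      exact Multiset.map_le_map hs)
    (by
      intro y hy
      obtain ⟨x, hx, rfl⟩ := Multiset.mem_map.1 hy
      rw [Ring.inverse_eq_inv', map_mul, map_inv₀, ← div_eq_inv_mul]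
      exact div_le_one_of_le₀ (hsv x hx) zero_le)
  simpa using this

variable {p : ℕ} [Fact p.Prime] {π : K} {e : ℕ}

theorem Polynomial.card_roots_near_le_of_card_support_le (hπ : v π < 1) (hπ0 : π ≠ 0)
    (he : 0 < e) (hpe : v (p : K) = v π ^ e) {t : ℕ} (ht : e + t < p) {g : K[X]} (hg : g ≠ 0)
    (hgt : g.support.card ≤ t + 1) {x₀ : K} (hx₀ : x₀ ≠ 0) {s : Multiset K} (hs : s ≤ g.roots)
    (hsv : ∀ x ∈ s, v (x - x₀) ≤ v (π * x₀)) : s.card ≤ t := by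
  refine card_roots_near_le hx₀ hπ0 ?_ hs hsv
  set b : ℕ → K := fun k => (taylor x₀ g).coeff k * x₀ ^ k with hb
  change ∃ j ≤ t, ∀ k, t < k → v (π ^ k * b k) < v (π ^ j * b j)
  obtain ⟨j, hj, hmax⟩ := (Finset.range (t + 1)).exists_max_image (fun i => v (π ^ i * b i))
    ⟨0, by simp⟩
  have hkey : ∀ k, t < k → v (k.factorial : K) * v (π ^ k * b k) ≤
      v π ^ (k - t) * v (π ^ j * b j) := by
    intro k hk
    obtain ⟨n, hn⟩ := Nat.exists_factorial_mul_choose_eq_sum hgt k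
    have h1 : (k.factorial : K) * b k = ∑ i ∈ Finset.range (t + 1), n i * (i.factorial * b i) := by
      simp only [hb, coeff_taylor_mul_pow, Finset.mul_sum]
      rw [Finset.sum_comm]
      refine Finset.sum_congr rfl fun i hi => ?_
      have h2 : (k.factorial * i.choose k : K) =
          ∑ j ∈ Finset.range (t + 1), (n j : K) * ((j.factorial : K) * (i.choose j : K)) := by
        have := congrArg (Int.cast : ℤ → K) (hn i hi)
        push_cast at this
        exact this
      rw [mul_left_comm, h2, Finset.mul_sum]
      refine Finset.sum_congr rfl fun j _ => by ring
    rw [← map_mul, mul_left_comm, h1, Finset.mul_sum]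
    refine v.map_sum_le fun i hi => ?_
    have hit : i ≤ t := Nat.lt_succ_iff.1 (Finset.mem_range.1 hi)
    have hpow : π ^ k = π ^ (k - t) * (π ^ (t - i) * π ^ i) := by
      rw [← pow_add, ← pow_add]; congr 1; omega
    have h3 : π ^ k * (n i * (i.factorial * b i)) =
        π ^ (k - t) * ((π ^ (t - i) * n i * (i.factorial : K)) * (π ^ i * b i)) := by
      rw [hpow]; ring
    rw [h3, map_mul, map_mul, map_pow]
    refine mul_le_mul_right ?_ _
    refine (mul_le_of_le_one_left' ?_).trans (hmax i hi)
    rw [map_mul, map_mul, map_pow]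
    exact mul_le_one' (mul_le_one' (pow_le_one' hπ.le _) (v.map_intCast_le_one _))
      (v.map_nat_le_one _)
  -- If all `b i` with `i ≤ t` vanished, `hkey` would kill every later one, as `k! ≠ 0` in `K`.
  have hpos : 0 < v (π ^ j * b j) := by
    rw [pos_iff_ne_zero]
    intro h0
    apply hg
    rw [← taylor_eq_zero x₀]
    ext k
    have : v (π ^ k * b k) = 0 := by
      rcases lt_or_ge t k with h | h
      · have h4 := hkey k h
        rw [h0, mul_zero, le_zero_iff, mul_eq_zero] at h4
        refine h4.resolve_left fun h5 => ?_
        have := Valuation.pow_sub_lt_map_factorial hπ hπ0 he hpe ht h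
        rw [h5] at this
        exact not_lt_zero this
      · have := hmax k (by simpa using Nat.lt_succ_of_le h)
        rwa [h0, le_zero_iff] at this
    rw [map_eq_zero] at this
    simpa [hb, hπ0, hx₀] using this
  refine ⟨j, by simpa [Nat.lt_succ_iff] using hj, fun k hk => ?_⟩
  have hf := Valuation.pow_sub_lt_map_factorial hπ hπ0 he hpe ht hk
  have h6 := (hkey k hk).trans_lt (mul_lt_mul_of_pos_right hf hpos)
  exact lt_of_mul_lt_mul_left h6 zero_le

/-- In `b₁ = ∑ i g_i x₀^i` the term `α` strictly dominates: earlier `i` are more divisible by `p`,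
later terms have smaller `|g_i x₀^i|`. So `|b₁| = w |p|^m`, while `k * choose i k = i * choose (i-1)
(k-1)` gives `|k b_k| ≤ w |p|^m`. -/
theorem Polynomial.card_roots_near_le_one_of_dvd (hπ : v π < 1) (hπ0 : π ≠ 0)
    (he : 0 < e) (hpe : v (p : K) = v π ^ e) (hep : e + 1 < p) {g : K[X]} {α m : ℕ}
    (hα : g.coeff α ≠ 0) (hαm : ¬ p ^ (m + 1) ∣ α)
    (hm : ∀ i, g.coeff i ≠ 0 → p ^ m ∣ i) (hlow : ∀ i < α, g.coeff i ≠ 0 → p ^ (m + 1) ∣ i)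
    {x₀ : K} (hx₀ : x₀ ≠ 0)
    (hle : ∀ i, v (g.coeff i * x₀ ^ i) ≤ v (g.coeff α * x₀ ^ α))
    (hlt : ∀ i, α < i → v (g.coeff i * x₀ ^ i) < v (g.coeff α * x₀ ^ α))
    {s : Multiset K} (hs : s ≤ g.roots)
    (hsv : ∀ x ∈ s, v (x - x₀) ≤ v (π * x₀)) : s.card ≤ 1 := by
  refine card_roots_near_le hx₀ hπ0 ⟨1, le_rfl, fun k hk => ?_⟩ hs hsv
  rw [coeff_taylor_mul_pow, coeff_taylor_mul_pow]
  have hπpos : 0 < v π := v.pos_iff.2 hπ0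
  have hp : v (p : K) < 1 := hpe ▸ pow_lt_one₀ zero_le hπ he.ne'
  have hppos : 0 < v (p : K) := hpe ▸ pow_pos hπpos e
  set w := v (g.coeff α * x₀ ^ α) with hw
  have hwpos : 0 < w := v.pos_iff.2 (mul_ne_zero hα (pow_ne_zero _ hx₀))
  have hdvd : ∀ {n i : ℕ}, p ^ n ∣ i → v (i : K) ≤ v (p : K) ^ n := by
    rintro n _ ⟨l, rfl⟩
    rw [Nat.cast_mul, map_mul, Nat.cast_pow, map_pow]
    exact mul_le_of_le_one_right' (v.map_nat_le_one l)
  have hα' : v (α : K) = v (p : K) ^ m := by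
    obtain ⟨l, hl⟩ := hm α hα
    have hpl : ¬ p ∣ l := fun ⟨r, hr⟩ => hαm ⟨r, by rw [hl, hr, pow_succ, mul_assoc]⟩
    rw [hl, Nat.cast_mul, map_mul, Valuation.map_natCast_eq_one hp hpl, mul_one, Nat.cast_pow,
      map_pow]
  have hsucc : v (p : K) ^ (m + 1) < v (p : K) ^ m := by
    rw [pow_succ]; exact mul_lt_of_lt_one_right (pow_pos hppos m) hp
  have hb1 : v (∑ i ∈ g.support, g.coeff i * x₀ ^ i * (i.choose 1 : K)) = w * v (p : K) ^ m := by
    rw [← Finset.add_sum_erase _ _ (mem_support_iff.2 hα)]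
    have hfirst : v (g.coeff α * x₀ ^ α * (α.choose 1 : K)) = w * v (p : K) ^ m := by
      rw [map_mul, Nat.choose_one_right, hα']
    rw [v.map_add_eq_of_lt_left, hfirst]
    rw [hfirst]
    refine v.map_sum_lt (mul_pos hwpos (pow_pos hppos m)).ne' fun i hi => ?_
    obtain ⟨hne, hi⟩ := Finset.mem_erase.1 hi
    rw [map_mul, Nat.choose_one_right]
    rcases hne.lt_or_gt with h | h
    · exact (mul_le_mul' (hle i) (hdvd (hlow i h (mem_support_iff.1 hi)))).trans_lt
        (mul_lt_mul_of_pos_left hsucc hwpos)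
    · exact (mul_le_mul' le_rfl (hdvd (hm i (mem_support_iff.1 hi)))).trans_lt
        (mul_lt_mul_of_pos_right (hlt i h) (pow_pos hppos m))
  have hbk : v (k : K) * v (∑ i ∈ g.support, g.coeff i * x₀ ^ i * (i.choose k : K)) ≤
      w * v (p : K) ^ m := by
    rw [← map_mul, Finset.mul_sum]
    refine v.map_sum_le fun i hi => ?_
    have hch : (k * i.choose k : K) = i * (i - 1).choose (k - 1) := by
      obtain ⟨l, rfl⟩ := Nat.exists_eq_add_of_lt hk
      rcases i with _ | i
      · simp
      · have := Nat.add_one_mul_choose_eq i (1 + l)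
        rw [mul_comm, Nat.add_sub_cancel, Nat.add_sub_cancel]
        exact_mod_cast congrArg (Nat.cast : ℕ → K) this.symm
    rw [mul_left_comm, hch, map_mul]
    refine mul_le_mul' (hle i) ?_
    rw [map_mul]
    exact (mul_le_of_le_one_right' (v.map_nat_le_one _)).trans (hdvd (hm i (mem_support_iff.1 hi)))
  -- The factorial estimate with `s = 1`, since `|k!| ≤ |k|`.
  have hfac : v π ^ (k - 1) < v (k : K) := by
    refine (Valuation.pow_sub_lt_map_factorial hπ hπ0 he hpe hep hk).trans_le ?_
    rw [← Nat.mul_factorial_pred (by omega), Nat.cast_mul, map_mul]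
    exact mul_le_of_le_one_right' (v.map_nat_le_one _)
  have hkpos : 0 < v (k : K) := zero_le.trans_lt hfac
  refine lt_of_mul_lt_mul_left (a := v (k : K)) ?_ zero_le
  rw [map_mul, map_mul v (π ^ 1), hb1, mul_left_comm, map_pow, map_pow, pow_one]
  refine (mul_le_mul' le_rfl hbk).trans_lt ?_
  rw [← mul_assoc (v (k : K))]
  refine mul_lt_mul_of_pos_right ?_ (mul_pos hwpos (pow_pos hppos m))
  obtain ⟨l, rfl⟩ := Nat.exists_eq_add_of_lt hk
  rw [pow_succ]
  exact mul_lt_mul_of_pos_right (by simpa using hfac) hπpos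

theorem Polynomial.card_roots_near_le_one (hπ : v π < 1) (hπ0 : π ≠ 0)
    (he : 0 < e) (hpe : v (p : K) = v π ^ e) (hep : e + 1 < p) {g : K[X]} {α α₀ m : ℕ}
    (hα : g.coeff α ≠ 0) (hα₀ : ∀ i, g.coeff i ≠ 0 → α₀ ≤ i) (hαm : ¬ p ^ (m + 1) ∣ α - α₀)
    (hm : ∀ i, g.coeff i ≠ 0 → p ^ m ∣ i - α₀)
    (hlow : ∀ i < α, g.coeff i ≠ 0 → p ^ (m + 1) ∣ i - α₀)
    {x₀ : K} (hx₀ : x₀ ≠ 0)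
    (hle : ∀ i, v (g.coeff i * x₀ ^ i) ≤ v (g.coeff α * x₀ ^ α))
    (hlt : ∀ i, α < i → v (g.coeff i * x₀ ^ i) < v (g.coeff α * x₀ ^ α))
    {s : Multiset K} (hs : s ≤ g.roots)
    (hsv : ∀ x ∈ s, v (x - x₀) ≤ v (π * x₀)) : s.card ≤ 1 := by
  have hg : g ≠ 0 := fun h => hα (by rw [h, coeff_zero])
  obtain ⟨c, hc⟩ : ∃ c, p ^ (m + 1) = c + 1 :=
    Nat.exists_eq_add_one_of_ne_zero (pow_ne_zero _ (Fact.out : p.Prime).ne_zero)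
  -- Multiplying by `X^(c α₀)` stands in for dividing by `X^α₀`: the new exponents are congruent to
  -- `i - α₀` modulo `p^(m+1)`.
  have hN : ∀ i, g.coeff i ≠ 0 → i + c * α₀ = i - α₀ + p ^ (m + 1) * α₀ := fun i hi => by
    have := hα₀ i hi
    rw [hc, Nat.add_mul]; omega
  have hpm : p ^ m ∣ p ^ (m + 1) := pow_dvd_pow p m.le_succ
  have hcoeff : ∀ i, (g * X ^ (c * α₀)).coeff i ≠ 0 →
      ∃ j, i = j + c * α₀ ∧ g.coeff j ≠ 0 := fun i hi => by
    rw [coeff_mul_X_pow'] at hi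
    split_ifs at hi with h
    · exact ⟨_, (Nat.sub_add_cancel h).symm, hi⟩
    · exact absurd rfl hi
  have hval : ∀ i, v ((g * X ^ (c * α₀)).coeff (i + c * α₀) * x₀ ^ (i + c * α₀)) =
      v (g.coeff i * x₀ ^ i) * v x₀ ^ (c * α₀) := fun i => by
    rw [coeff_mul_X_pow, pow_add, ← mul_assoc, map_mul, map_pow]
  have hxpos : 0 < v x₀ ^ (c * α₀) := pow_pos (v.pos_iff.2 hx₀) _
  refine card_roots_near_le_one_of_dvd (g := g * X ^ (c * α₀)) (α := α + c * α₀) (m := m)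
    hπ hπ0 he hpe hep (by rwa [coeff_mul_X_pow]) ?_ ?_ ?_ hx₀ ?_ ?_
    (hs.trans (roots.le_of_dvd (mul_ne_zero hg (pow_ne_zero _ X_ne_zero)) (dvd_mul_right _ _))) hsv
  · rw [hN α hα, Nat.dvd_add_left (dvd_mul_right _ _)]
    exact hαm
  · intro i hi
    obtain ⟨j, rfl, hj⟩ := hcoeff i hi
    rw [hN j hj]
    exact dvd_add (hm j hj) (hpm.mul_right _)
  · intro i hiα hi
    obtain ⟨j, rfl, hj⟩ := hcoeff i hi
    rw [hN j hj]
    exact dvd_add (hlow j (by omega) hj) (dvd_mul_right _ _)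
  · intro i
    by_cases hi : (g * X ^ (c * α₀)).coeff i = 0
    · rw [hi, zero_mul, map_zero]; exact zero_le
    · obtain ⟨j, rfl, hj⟩ := hcoeff i hi
      rw [hval, hval]
      exact mul_le_mul' (hle j) le_rfl
  · intro i hiα
    by_cases hi : (g * X ^ (c * α₀)).coeff i = 0
    · rw [hi, zero_mul, map_zero, hval]
      exact mul_pos (v.pos_iff.2 (mul_ne_zero hα (pow_ne_zero _ hx₀))) hxpos
    · obtain ⟨j, rfl, hj⟩ := hcoeff i hi
      rw [hval, hval]
      exact mul_lt_mul_of_pos_right (hlt j (by omega)) hxpos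

end LocalBounds

/-! ### Grouping the roots by Newton polygon edge and residue class -/

section Counting

theorem Multiset.card_eq_sum_card_filter {α ι : Type*} [DecidableEq ι] (s : Multiset α)
    (f : α → ι) (E : Finset ι) (hf : ∀ a ∈ s, f a ∈ E) :
    s.card = ∑ i ∈ E, (s.filter fun a => f a = i).card := by
  rw [← Multiset.card_map f s, ← Multiset.sum_count_eq_card (s := E) (m := s.map f) (by simpa using hf)]
  refine Finset.sum_congr rfl fun i _ => ?_
  rw [Multiset.count_map]
  simp only [eq_comm]

variable {K Γ : Type*} [Field K] [LinearOrderedCommGroupWithZero Γ] {v : Valuation K Γ}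

theorem Multiset.card_le_mul_of_residue {κ : Type*} [Zero κ] [Fintype κ] {r : K → κ} {π : K}
    (hgap : ∀ x, v x < 1 → v x ≤ v π)
    (hr : ∀ x y, v x = 1 → v y = 1 → r x = r y → v (x - y) < 1)
    (hr0 : ∀ x, v x = 1 → r x ≠ 0) {s : Multiset K} (hs0 : 0 ∉ s)
    (hsv : ∀ x ∈ s, ∀ y ∈ s, v x = v y) {d : ℕ}
    (hd : ∀ x₀ ∈ s, ∀ u ≤ s, (∀ x ∈ u, v (x - x₀) ≤ v (π * x₀)) → u.card ≤ d) :
    s.card ≤ d * (Fintype.card κ - 1) := by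
  classical
  rcases s.empty_or_exists_mem with rfl | ⟨x₁, hx₁⟩
  · simp
  have hx₁0 : x₁ ≠ 0 := fun h => hs0 (h ▸ hx₁)
  have hunit : ∀ x ∈ s, v (x / x₁) = 1 := fun x hx => by
    rw [map_div₀, hsv x hx x₁ hx₁, div_self ((v.ne_zero_iff).2 hx₁0)]
  rw [s.card_eq_sum_card_filter (fun x => r (x / x₁)) (Finset.univ.erase 0)
    (fun x hx => by simpa using hr0 _ (hunit x hx))]
  have hc : (Finset.univ.erase (0 : κ)).card = Fintype.card κ - 1 := by
    rw [Finset.card_erase_of_mem (Finset.mem_univ _), Finset.card_univ]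
  rw [← hc, mul_comm, ← smul_eq_mul]
  refine Finset.sum_le_card_nsmul _ _ _ fun c _ => ?_
  rcases (s.filter fun x => r (x / x₁) = c).empty_or_exists_mem with h | ⟨x₀, hx₀⟩
  · rw [h]; simp
  rw [Multiset.mem_filter] at hx₀
  refine hd x₀ hx₀.1 _ (Multiset.filter_le _ _) fun x hx => ?_
  rw [Multiset.mem_filter] at hx
  have hx₀0 : x₀ ≠ 0 := fun h => hs0 (h ▸ hx₀.1)
  have hx₀v : 0 < v x₀ := v.pos_iff.2 hx₀0
  have h1 := hr _ _ (hunit x hx.1) (hunit x₀ hx₀.1) (hx.2.trans hx₀.2.symm)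
  rw [← sub_div, map_div₀, hsv x₁ hx₁ x₀ hx₀.1, ← map_div₀] at h1
  have h2 := hgap _ h1
  rwa [map_div₀, div_le_iff₀ hx₀v, ← map_mul] at h2

theorem Polynomial.exists_top_index (v : Valuation K Γ) {g : K[X]} (hg : g ≠ 0) (x : K)
    (hx : x ≠ 0) : ∃ α, g.coeff α ≠ 0 ∧
      (∀ i, v (g.coeff i * x ^ i) ≤ v (g.coeff α * x ^ α)) ∧
      ∀ i, α < i → v (g.coeff i * x ^ i) < v (g.coeff α * x ^ α) := by
  -- The lexicographic order breaks ties in favour of the larger index.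
  obtain ⟨α, hα, hmax⟩ := g.support.exists_max_image
    (fun i => toLex (v (g.coeff i * x ^ i), i)) (nonempty_support_iff.2 hg)
  rw [mem_support_iff] at hα
  have hpos : 0 < v (g.coeff α * x ^ α) := v.pos_iff.2 (mul_ne_zero hα (pow_ne_zero _ hx))
  refine ⟨α, hα, fun i => ?_, fun i hi => ?_⟩
  · by_cases h : g.coeff i = 0
    · rw [h, zero_mul, map_zero]; exact zero_le
    · rcases Prod.Lex.toLex_le_toLex.1 (hmax i (mem_support_iff.2 h)) with h | h
      · exact h.le
      · exact h.1.le
  · by_cases h : g.coeff i = 0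
    · rw [h, zero_mul, map_zero]; exact hpos
    · rcases Prod.Lex.toLex_le_toLex.1 (hmax i (mem_support_iff.2 h)) with h | h
      · exact h
      · exact absurd h.2 (not_le.2 hi)

/-- A vanishing sum cannot have a single term of maximal valuation. -/
theorem Polynomial.exists_tie_of_isRoot {g : K[X]} {y : K} (hy : g.IsRoot y) (hy0 : y ≠ 0) {α : ℕ}
    (hα : g.coeff α ≠ 0) (hle : ∀ i, v (g.coeff i * y ^ i) ≤ v (g.coeff α * y ^ α))
    (hlt : ∀ i, α < i → v (g.coeff i * y ^ i) < v (g.coeff α * y ^ α)) :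
    ∃ i < α, g.coeff i ≠ 0 ∧ v (g.coeff i * y ^ i) = v (g.coeff α * y ^ α) := by
  by_contra! hno
  have hne : v (g.coeff α * y ^ α) ≠ 0 := v.ne_zero_iff.2 (mul_ne_zero hα (pow_ne_zero _ hy0))
  have hsum : g.coeff α * y ^ α + ∑ i ∈ g.support.erase α, g.coeff i * y ^ i = 0 := by
    rw [Finset.add_sum_erase g.support (fun i => g.coeff i * y ^ i) (mem_support_iff.2 hα)]
    rw [IsRoot, eval_eq_sum, Polynomial.sum] at hy
    exact hy
  have hlt' : v (∑ i ∈ g.support.erase α, g.coeff i * y ^ i) < v (g.coeff α * y ^ α) := by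
    refine v.map_sum_lt hne fun i hi => ?_
    obtain ⟨h, hi⟩ := Finset.mem_erase.1 hi
    rcases h.lt_or_gt with h | h
    · exact (hle i).lt_of_ne (hno i h (mem_support_iff.1 hi))
    · exact hlt i h
  have := v.map_add_eq_of_lt_left hlt'
  rw [hsum, map_zero] at this
  exact hne this.symm

/-- The tie says `|g_i| = |g_α| |y|^(α-i)`, and dominance at `x` says `|g_i| ≤ |g_α| |x|^(α-i)`.
Used in both directions, this equates the valuations of roots sharing a top index. -/
theorem Polynomial.map_le_map_of_tie {g : K[X]} {x y : K} {α i : ℕ} (hx0 : x ≠ 0)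
    (hα : g.coeff α ≠ 0) (hi : i < α)
    (htie : v (g.coeff i * y ^ i) = v (g.coeff α * y ^ α)) (hy0 : y ≠ 0)
    (hle : v (g.coeff i * x ^ i) ≤ v (g.coeff α * x ^ α)) : v y ≤ v x := by
  obtain ⟨l, rfl⟩ := Nat.exists_eq_add_of_lt hi
  have hapos : 0 < v (g.coeff (i + l + 1)) := v.pos_iff.2 hα
  simp only [map_mul, map_pow] at htie hle
  have hyi : 0 < v y ^ i := pow_pos (v.pos_iff.2 hy0) i
  have hxi : 0 < v x ^ i := pow_pos (v.pos_iff.2 hx0) i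
  have h1 : v (g.coeff i) = v (g.coeff (i + l + 1)) * v y ^ (l + 1) := by
    refine mul_right_cancel₀ hyi.ne' ?_
    rw [htie, mul_assoc, ← pow_add]; congr 2; omega
  have h2 : v (g.coeff i) ≤ v (g.coeff (i + l + 1)) * v x ^ (l + 1) := by
    refine le_of_mul_le_mul_right (hle.trans_eq ?_) hxi
    rw [mul_assoc, ← pow_add]; congr 2; omega
  rw [h1] at h2
  exact le_of_pow_le_pow_left₀ l.succ_ne_zero zero_le (le_of_mul_le_mul_left h2 hapos)

theorem Nat.exists_pow_dvd_and_not_pow_succ_dvd {p : ℕ} (hp : 1 < p) {P : ℕ → Prop}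
    (f : ℕ → ℕ) (hP : ∃ i, P i ∧ f i ≠ 0) :
    ∃ m, (∀ i, P i → p ^ m ∣ f i) ∧ ∃ i, P i ∧ ¬ p ^ (m + 1) ∣ f i := by
  by_contra! h
  have hall : ∀ m, ∀ i, P i → p ^ m ∣ f i := fun m => by
    induction m with
    | zero => simp
    | succ m ih => exact h m ih
  obtain ⟨i, hi, hfi⟩ := hP
  exact (Nat.lt_pow_self hp).not_ge (Nat.le_of_dvd (Nat.pos_of_ne_zero hfi) (hall (f i) i hi))

variable {p : ℕ} [Fact p.Prime] {π : K} {e : ℕ}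

theorem numNonzeroRoots_le_of_valuation (hπ : v π < 1) (hπ0 : π ≠ 0)
    (he : 0 < e) (hpe : v (p : K) = v π ^ e) (hgap : ∀ x, v x < 1 → v x ≤ v π)
    {κ : Type*} [Zero κ] [Fintype κ] {r : K → κ}
    (hr : ∀ x y, v x = 1 → v y = 1 → r x = r y → v (x - y) < 1)
    (hr0 : ∀ x, v x = 1 → r x ≠ 0)
    {t : ℕ} (ht : e + t < p) {g : K[X]} (hg : g ≠ 0) (hgt : g.support.card ≤ t + 1) :
    numNonzeroRoots g ≤ (t ^ 2 - t + 1) * (Fintype.card κ - 1) := by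
  classical
  rw [numNonzeroRoots]
  set R : Multiset K := g.roots.filter fun x => x ≠ 0 with hR
  set q := Fintype.card κ - 1 with hq
  have hRg : R ≤ g.roots := Multiset.filter_le _ _
  have hRmem : ∀ x ∈ R, g.IsRoot x ∧ x ≠ 0 := fun x hx => by
    rw [hR, Multiset.mem_filter, mem_roots hg] at hx
    exact hx
  choose! top htop hle hlt using exists_top_index v hg
  have htie : ∀ x ∈ R, ∃ i < top x, g.coeff i ≠ 0 ∧
      v (g.coeff i * x ^ i) = v (g.coeff (top x) * x ^ top x) := fun x hx => by
    obtain ⟨h, h0⟩ := hRmem x hx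
    exact exists_tie_of_isRoot h h0 (htop x h0) (hle x h0) (hlt x h0)
  have hvle : ∀ x ∈ R, ∀ y ∈ R, top x = top y → v y ≤ v x := fun x hx y hy hxy => by
    obtain ⟨i, hi, -, h⟩ := htie y hy
    have hx0 := (hRmem x hx).2
    have hy0 := (hRmem y hy).2
    exact map_le_map_of_tie hx0 (htop y hy0) hi h hy0 (hxy ▸ hle x hx0 i)
  have hsupp := nonempty_support_iff.2 hg
  set α₀ := g.support.min' hsupp with hα₀
  have hα₀le : ∀ i, g.coeff i ≠ 0 → α₀ ≤ i := fun i hi =>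
    Finset.min'_le _ _ (mem_support_iff.2 hi)
  set E := g.support.erase α₀ with hE
  have hEcard : E.card ≤ t := by
    rw [hE, Finset.card_erase_of_mem (Finset.min'_mem _ _)]; omega
  have htopE : ∀ x ∈ R, top x ∈ E := fun x hx => by
    obtain ⟨i, hi, hi0, -⟩ := htie x hx
    rw [hE, Finset.mem_erase, mem_support_iff]
    exact ⟨((hα₀le i hi0).trans_lt hi).ne', htop x (hRmem x hx).2⟩
  have hfib : ∀ (β d : ℕ), (∀ x₀ ∈ R, top x₀ = β → ∀ u ≤ R,
      (∀ x ∈ u, v (x - x₀) ≤ v (π * x₀)) → u.card ≤ d) →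
      (R.filter fun x => top x = β).card ≤ d * q := by
    intro β d hd
    refine Multiset.card_le_mul_of_residue hgap hr hr0 ?_ ?_ ?_
    · exact fun h => (hRmem 0 (Multiset.mem_filter.1 h).1).2 rfl
    · intro x hx y hy
      rw [Multiset.mem_filter] at hx hy
      exact le_antisymm (hvle y hy.1 x hx.1 (hy.2.trans hx.2.symm))
        (hvle x hx.1 y hy.1 (hx.2.trans hy.2.symm))
    · intro x₀ hx₀ u hu
      rw [Multiset.mem_filter] at hx₀
      exact hd x₀ hx₀.1 hx₀.2 u (hu.trans (Multiset.filter_le _ _))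
  have hgen : ∀ β, (R.filter fun x => top x = β).card ≤ t * q := fun β =>
    hfib β t fun x₀ hx₀ _ u hu => card_roots_near_le_of_card_support_le hπ hπ0 he hpe ht hg hgt
      (hRmem x₀ hx₀).2 (hu.trans hRg)
  rw [R.card_eq_sum_card_filter top E htopE]
  rcases E.eq_empty_or_nonempty with h | ⟨j, hj⟩
  · rw [h]; simp
  have ht1 : 1 ≤ t := (Finset.card_pos.2 ⟨j, hj⟩).trans_le hEcard
  -- `p^m` is the exact power of `p` dividing all the differences `i - α₀`; the special `α` is the
  -- least exponent where `p^(m+1)` fails to divide.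
  obtain ⟨m, hm, hex⟩ := Nat.exists_pow_dvd_and_not_pow_succ_dvd (p := p)
    (Fact.out : p.Prime).one_lt (P := fun i => g.coeff i ≠ 0) (fun i => i - α₀) ⟨j, by
      rw [hE, Finset.mem_erase, mem_support_iff] at hj
      have := hα₀le j hj.2
      exact ⟨hj.2, by omega⟩⟩
  obtain ⟨hα, hαm⟩ := Nat.find_spec hex
  set α := Nat.find hex with hαdef
  have hlow : ∀ i < α, g.coeff i ≠ 0 → p ^ (m + 1) ∣ i - α₀ := fun i hi hi0 => by
    have := Nat.find_min hex hi
    by_contra h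
    exact this ⟨hi0, h⟩
  have hαE : α ∈ E := by
    rw [hE, Finset.mem_erase, mem_support_iff]
    refine ⟨fun h => hαm ?_, hα⟩
    rw [h]; simp
  have hone : (R.filter fun x => top x = α).card ≤ 1 * q :=
    hfib α 1 fun x₀ hx₀ hx₀α u hu => by
      have hx₀0 := (hRmem x₀ hx₀).2
      have h1 := hle x₀ hx₀0
      have h2 := hlt x₀ hx₀0
      rw [hx₀α] at h1 h2
      exact card_roots_near_le_one hπ hπ0 he hpe (by omega) hα hα₀le hαm hm hlow hx₀0 h1 h2
        (hu.trans hRg)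
  rw [← Finset.add_sum_erase _ _ hαE]
  have hrest : ∑ β ∈ E.erase α, (R.filter fun x => top x = β).card ≤ (t - 1) * (t * q) :=
    (Finset.sum_le_card_nsmul _ _ _ fun β _ => hgen β).trans (by
      rw [smul_eq_mul]
      refine Nat.mul_le_mul_right _ ?_
      rw [Finset.card_erase_of_mem hαE]; omega)
  refine (add_le_add hone hrest).trans_eq ?_
  obtain ⟨l, rfl⟩ := Nat.exists_eq_add_of_le' ht1
  have : (l + 1) ^ 2 - (l + 1) = l * (l + 1) := by
    rw [pow_two, Nat.sub_eq_of_eq_add]; ring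
  rw [this, Nat.add_sub_cancel]; ring

end Counting

/-! ### Passage to the adic valuation of a Dedekind domain -/

section DedekindDomain

open IsDedekindDomain

variable {O K : Type*} [CommRing O] [IsDedekindDomain O] [Field K] [Algebra O K] [IsFractionRing O K]

/-- Each `x` with valuation at most 1 is congruent to some `a ∈ O`; `r x` is the class of a chosen
`a`. The count needs no compatibility with the ring structure. -/
theorem IsDedekindDomain.HeightOneSpectrum.exists_residue_map (P : HeightOneSpectrum O) :
    ∃ r : K → O ⧸ P.asIdeal,
      (∀ x y, P.valuation K x = 1 → P.valuation K y = 1 → r x = r y → P.valuation K (x - y) < 1) ∧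
      ∀ x, P.valuation K x = 1 → r x ≠ 0 := by
  have h : ∀ x : K, ∃ a : O, P.valuation K x ≤ 1 → P.valuation K (algebraMap O K a - x) < 1 :=
    fun x => by
      by_cases hx : P.valuation K x ≤ 1
      · obtain ⟨a, ha⟩ := P.exists_valuation_sub_lt_of_integer hx 1
        exact ⟨a, fun _ => by simpa using ha⟩
      · exact ⟨0, fun h => absurd h hx⟩
  choose a ha using h
  refine ⟨fun x => Ideal.Quotient.mk P.asIdeal (a x), fun x y hx hy hxy => ?_, fun x hx h0 => ?_⟩
  · rw [Ideal.Quotient.eq, ← P.valuation_lt_one_iff_mem (K := K)] at hxy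
    change P.valuation K (algebraMap O K (a x - a y)) < 1 at hxy
    rw [map_sub (algebraMap O K)] at hxy
    have heq : x - y = (algebraMap O K (a x) - algebraMap O K (a y)) -
        (algebraMap O K (a x) - x) + (algebraMap O K (a y) - y) := by ring
    rw [heq]
    exact Valuation.map_add_lt _ ((Valuation.map_sub _ _ _).trans_lt (max_lt hxy (ha x hx.le)))
      (ha y hy.le)
  · rw [Ideal.Quotient.eq_zero_iff_mem, ← P.valuation_lt_one_iff_mem (K := K)] at h0
    have : P.valuation K x < 1 := by
      have heq : x = algebraMap O K (a x) - (algebraMap O K (a x) - x) := by ring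
      rw [heq]
      exact (Valuation.map_sub _ _ _).trans_lt (max_lt h0 (ha x hx.le))
    exact this.ne hx

theorem IsDedekindDomain.HeightOneSpectrum.valuation_algebraMap_eq_exp {A : Type*} [CommRing A]
    [Algebra A O] (P : HeightOneSpectrum O) (a : A) [P.asIdeal.LiesOver (Ideal.span {a})]
    (ha : algebraMap A O a ≠ 0) :
    P.valuation K (algebraMap O K (algebraMap A O a)) =
      WithZero.exp (-1 : ℤ) ^ (P.asIdeal.ramificationIdx A) := by
  have hmap : (Ideal.span {a}).map (algebraMap A O) = Ideal.span {algebraMap A O a} := by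
    rw [Ideal.map_span, Set.image_singleton]
  have hne : Ideal.span {algebraMap A O a} ≠ ⊥ := by simpa using ha
  rw [P.valuation_of_algebraMap, P.intValuation_eq_exp_neg_multiplicity ha,
    Ideal.IsDedekindDomain.ramificationIdx_eq_multiplicity (Ideal.span {a}) P.asIdeal (by rwa [hmap]), hmap,
    ← WithZero.exp_nsmul]
  simp

theorem IsDedekindDomain.HeightOneSpectrum.numNonzeroRoots_le (P : HeightOneSpectrum O)
    [Finite (O ⧸ P.asIdeal)] {p e : ℕ} [Fact p.Prime] (he : 0 < e)
    (hpe : P.valuation K (p : K) = WithZero.exp (-1 : ℤ) ^ e) {t : ℕ} (ht : e + t < p)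
    {g : K[X]} (hg : g ≠ 0) (hgt : g.support.card ≤ t + 1) :
    numNonzeroRoots g ≤ (t ^ 2 - t + 1) * (P.asIdeal.cardQuot - 1) := by
  obtain ⟨π, hπ⟩ := P.valuation_exists_uniformizer K
  obtain ⟨r, hr, hr0⟩ := P.exists_residue_map (K := K)
  have := Fintype.ofFinite (O ⧸ P.asIdeal)
  have hcard : P.asIdeal.cardQuot = Fintype.card (O ⧸ P.asIdeal) := by
    rw [Submodule.cardQuot_apply, Nat.card_eq_fintype_card]
  rw [hcard]
  refine numNonzeroRoots_le_of_valuation (v := P.valuation K) (π := π) ?_ ?_ he ?_ ?_ hr hr0 ht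
    hg hgt
  · rw [hπ, ← WithZero.exp_zero, WithZero.exp_lt_exp]; norm_num
  · rintro rfl
    rw [map_zero] at hπ
    exact WithZero.exp_ne_zero hπ.symm
  · rw [hpe, hπ]
  · intro x hx
    rw [hπ]
    rcases eq_or_ne x 0 with rfl | h0
    · simp
    · have hx0 : P.valuation K x ≠ 0 := (Valuation.ne_zero_iff _).2 h0
      rw [← WithZero.exp_log hx0] at hx ⊢
      rw [← WithZero.exp_zero, WithZero.exp_lt_exp] at hx
      rw [WithZero.exp_le_exp]
      omega

end DedekindDomain

/-! ### Finite extensions of the `p`-adic numbers -/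

theorem theorem3 (p : ℕ) [Fact p.Prime] (K : Type*) [Field K] [Algebra ℚ_[p] K]
    [FiniteDimensional ℚ_[p] K] [Algebra ℤ_[p] K] [IsScalarTower ℤ_[p] ℚ_[p] K]
    (M : Ideal (integralClosure ℤ_[p] K)) [M.IsMaximal] (e f : ℕ)
    (he : M.ramificationIdx ℤ_[p] = e) (hf : M.inertiaDeg ℤ_[p] = f)
    (t : ℕ) (hp : e + t < p) :
    Bmult t K ≤ (((t ^ 2 - t + 1) * (p ^ f - 1) : ℕ) : ℕ∞) := by
  have : CharZero K := charZero_of_injective_algebraMap (algebraMap ℚ_[p] K).injective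
  have : Algebra.IsSeparable ℚ_[p] K := inferInstance
  have : IsDedekindDomain (integralClosure ℤ_[p] K) :=
    integralClosure.isDedekindDomain ℤ_[p] ℚ_[p] K
  have : IsFractionRing (integralClosure ℤ_[p] K) K :=
    integralClosure.isFractionRing_of_finite_extension ℚ_[p] K
  have : Module.Finite ℤ_[p] (integralClosure ℤ_[p] K) :=
    IsIntegralClosure.finite ℤ_[p] ℚ_[p] K (integralClosure ℤ_[p] K)
  -- By integrality `M` contracts to a maximal ideal, and `ℤ_[p]` is local.
  have hunder : M.under ℤ_[p] = Ideal.span {(p : ℤ_[p])} := by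
    have : (M.under ℤ_[p]).IsMaximal := Ideal.isMaximal_comap_of_isIntegral_of_isMaximal M
    rw [IsLocalRing.eq_maximalIdeal this, PadicInt.maximalIdeal_eq_span_p]
  have hmax : (Ideal.span {(p : ℤ_[p])}).IsMaximal := by
    rw [← PadicInt.maximalIdeal_eq_span_p]; infer_instance
  have hover : M.LiesOver (Ideal.span {(p : ℤ_[p])}) := ⟨hunder.symm⟩
  have hpK : (algebraMap ℤ_[p] (integralClosure ℤ_[p] K)) p ≠ 0 := by
    rw [map_natCast]
    intro h
    have := congrArg (algebraMap (integralClosure ℤ_[p] K) K) h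
    rw [map_natCast, map_zero] at this
    exact (Fact.out : p.Prime).ne_zero (by exact_mod_cast this)
  have hpM : (algebraMap ℤ_[p] (integralClosure ℤ_[p] K)) p ∈ M := by
    have : (p : ℤ_[p]) ∈ M.under ℤ_[p] := by
      rw [hunder]; exact Ideal.mem_span_singleton_self _
    exact this
  let P : IsDedekindDomain.HeightOneSpectrum (integralClosure ℤ_[p] K) :=
    ⟨M, inferInstance, fun h => hpK (by rwa [h, Ideal.mem_bot] at hpM)⟩
  have hoverP : P.asIdeal.LiesOver (Ideal.span {(p : ℤ_[p])}) := hover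
  have hval : P.valuation K (p : K) = WithZero.exp (-1 : ℤ) ^ e := by
    have := P.valuation_algebraMap_eq_exp (K := K) (p : ℤ_[p]) hpK
    rwa [map_natCast, map_natCast, he] at this
  have hepos : 0 < e := by
    rw [Nat.pos_iff_ne_zero]
    rintro h
    have h1 := (P.valuation_lt_one_iff_mem (K := K) _).2 hpM
    change P.valuation K (algebraMap _ K (algebraMap ℤ_[p] _ p)) < 1 at h1
    rw [map_natCast, map_natCast, hval, h, pow_zero] at h1
    exact lt_irrefl _ h1
  have hcardp : (Ideal.span {(p : ℤ_[p])}).cardQuot = p := by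
    rw [Submodule.cardQuot_apply, ← PadicInt.maximalIdeal_eq_span_p]
    exact (Nat.card_congr (PadicInt.residueField (p := p)).toEquiv).trans (Nat.card_zmod p)
  have hcard : P.asIdeal.cardQuot = p ^ f := by
    rw [← hf, ← Ideal.cardQuot_pow_inertiaDeg (Ideal.span {(p : ℤ_[p])}) M, hcardp]
  have hfin : Finite (integralClosure ℤ_[p] K ⧸ P.asIdeal) := by
    refine Nat.finite_of_card_ne_zero ?_
    rw [← Submodule.cardQuot_apply, hcard]
    exact pow_ne_zero _ (Fact.out : p.Prime).ne_zero
  refine iSup_le fun ⟨g, hg, hgt⟩ => ?_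
  rw [← hcard]
  exact_mod_cast P.numNonzeroRoots_le hepos hval hp hg hgt
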